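/- Let $F$ be the free product of nontrivial groups $A_i$ $(i\in I)$ and of a free group with basis $\{g_j \mid j\in J\}$, where $I$ and $J$ are arbitrary (disjoint) index sets. Let $\varepsilon:\mathbf{Z}[F]\to\mathbf{Z}$ be the augmentation of the integral group ring, and call a map $\partial:\mathbf{Z}[F]\to\mathbf{Z}[F]$ a derivation if $\partial(u+v)=\partial(u)+\partial(v)$ and $\partial(uv)=\partial(u)v+\varepsilon(u)\partial(v)$ for all $u,v\in\mathbf{Z}[F]$. For $k\in I\cup J$ let $D_k$ be the Fox derivative, i.e. the unique derivation of $\mathbf{Z}[F]$ such that, for all $j\in J$, $D_k(g_j)=1$ if $k=j$ and $D_k(g_j)=0$ otherwise, and, for all $i\in I$ and $a\in A_i$, $D_k(a)=a-1$ if $k=i$ and $D_k(a)=0$ otherwise. Let $N$ be a normal subgroup of $F$, let $K\subseteq I\cup J$, let $F_K$ be the subgroup of $F$ generated by $\{g_j\mid j\in K\cap J\}$ and the groups $A_i$ $(i\in K\cap I)$, and let $v\in F$. For $X\subseteq F$ write $X^F$ for the normal subgroup of $F$ generated by $X$. Let $M$ be the product of the subgroup generated by all $(N\cap A_i)^F$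 $(i\in I)$ and the commutator subgroup $[N,N]$, and let $\mathbf{Z}[F](N-1)$ be the left ideal of $\mathbf{Z}[F]$ generated by $\{n-1\mid n\in N\}$. Then $$D_k(v)\equiv 0 \pmod{\mathbf{Z}[F](N-1)}\quad\text{for all } k\in (I\cup J)\setminus K$$ if and only if there is an element $\hat v\in F_K$ such that $v\hat v^{-1}\in (F_K\cap N)^F M$. -/

import Mathlib

namespace FoxCalculus

universe u v w

variable {I : Type u} (A : I → Type v) [∀ i, Group (A i)] (J : Type w)

/-- The group `F`: the free product of the groups `A i` and of the free group on `J`. -/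
abbrev FreeProd := Monoid.Coprod (Monoid.CoprodI A) (FreeGroup J)

/-- The integral group ring `ℤ[F]`. -/
abbrev GroupRing := MonoidAlgebra ℤ (FreeProd A J)

variable {J}

/-- The canonical embedding `A i → F`. -/
def factor (i : I) : A i →* FreeProd A J :=
  Monoid.Coprod.inl.comp (Monoid.CoprodI.of (M := A) (i := i))

/-- The free generator `g j` of `F`. -/
def gen (j : J) : FreeProd A J := Monoid.Coprod.inr (FreeGroup.of j)

variable {A}

/-- The inclusion `F → ℤ[F]`. -/
noncomputable abbrev grp (f : FreeProd A J) : GroupRing A J :=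
  MonoidAlgebra.of ℤ (FreeProd A J) f

/-- The augmentation `ε : ℤ[F] → ℤ`, the linear extension of the trivial map `F → 1`. -/
noncomputable def aug : GroupRing A J →ₐ[ℤ] ℤ :=
  MonoidAlgebra.lift ℤ ℤ (FreeProd A J) 1

/-- Derivations `∂` of `ℤ[F]`: `∂(u + v) = ∂(u) + ∂(v)` and `∂(u v) = ∂(u) v + ε(u) ∂(v)`. -/
structure IsDerivation (d : GroupRing A J → GroupRing A J) : Prop where
  add : ∀ u v, d (u + v) = d u + d v
  mul : ∀ u v, d (u * v) = d u * v + aug u • d v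

open Classical in
/-- The conditions that characterise the Fox derivative with index `k`. -/
structure IsFoxDerivative (k : I ⊕ J) (d : GroupRing A J → GroupRing A J) : Prop where
  isDerivation : IsDerivation d
  gen : ∀ j, d (grp (gen A j)) = if k = Sum.inr j then 1 else 0
  factor : ∀ i (a : A i),
    d (grp (factor A i a)) = if k = Sum.inl i then grp (factor A i a) - 1 else 0

/-- An element `f` of `F` and an element `x` of `ℤ[F]` give the invertible matrix
`(1, x; 0, f)`. Multiplying two such matrices gives `(1, x * g + y; 0, f * g)`. -/
noncomputable def triUnit (f : FreeProd A J) (x : GroupRing A J) :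
    (Matrix (Fin 2) (Fin 2) (GroupRing A J))ˣ where
  val := !![1, x; 0, grp f]
  inv := !![1, -(x * grp f⁻¹); 0, grp f⁻¹]
  val_inv := by
    simp only [Matrix.mul_fin_two, ← map_mul]
    simp [Matrix.one_fin_two, ← MonoidAlgebra.one_def]
  inv_val := by
    simp only [Matrix.mul_fin_two, mul_assoc, neg_mul, ← map_mul]
    simp [Matrix.one_fin_two, ← MonoidAlgebra.one_def]

theorem triUnit_mul (f g : FreeProd A J) (x y : GroupRing A J) :
    triUnit f x * triUnit g y = triUnit (f * g) (x * grp g + y) := by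
  ext1
  simp only [triUnit, Units.val_mul, Matrix.mul_fin_two, map_mul]
  simp [add_comm]

open Classical in
/-- The homomorphism `f ↦ (1, D_k(f); 0, f)`, given by its values on the free factors. -/
noncomputable def foxHom (k : I ⊕ J) :
    FreeProd A J →* (Matrix (Fin 2) (Fin 2) (GroupRing A J))ˣ :=
  Monoid.Coprod.lift
    (Monoid.CoprodI.lift fun i =>
      { toFun := fun a => triUnit (factor A i a)
          (if k = Sum.inl i then grp (factor A i a) - 1 else 0)
        map_one' := by
          ext1
          simp [triUnit, Matrix.one_fin_two, ← MonoidAlgebra.one_def]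
        map_mul' := fun a b => by
          rw [triUnit_mul, map_mul]
          congr 1
          split_ifs
          · simp [sub_mul]
          · simp })
    (FreeGroup.lift fun j => triUnit (gen A j) (if k = Sum.inr j then 1 else 0))

/-- The Fox derivative `D_k : ℤ[F] → ℤ[F]`: the upper right entry of the linear extension of
`f ↦ (1, D_k(f); 0, f)` to `ℤ[F]`. -/
noncomputable def foxDeriv (k : I ⊕ J) (u : GroupRing A J) : GroupRing A J :=
  MonoidAlgebra.lift ℤ (Matrix (Fin 2) (Fin 2) (GroupRing A J)) (FreeProd A J)
    ((Units.coeHom _).comp (foxHom k)) u 0 1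

theorem foxHom_factor (k : I ⊕ J) (i : I) (a : A i) [Decidable (k = Sum.inl i)] :
    foxHom k (factor A i a) = triUnit (factor A i a)
      (if k = Sum.inl i then grp (factor A i a) - 1 else 0) := by
  simp only [foxHom, factor, MonoidHom.comp_apply, Monoid.Coprod.lift_apply_inl,
    Monoid.CoprodI.lift_of, MonoidHom.coe_mk, OneHom.coe_mk]
  congr

theorem foxHom_gen (k : I ⊕ J) (j : J) [Decidable (k = Sum.inr j)] :
    foxHom k (gen A j) = triUnit (gen A j) (if k = Sum.inr j then 1 else 0) := by
  simp only [foxHom, gen, Monoid.Coprod.lift_apply_inr, FreeGroup.lift_apply_of]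
  congr

/-- `F` is generated by the groups `A i` and the elements `g j`. -/
theorem freeProd_induction {P : FreeProd A J → Prop} (one : P 1)
    (hf : ∀ i (a : A i), P (factor A i a)) (hg : ∀ j, P (gen A j))
    (mul : ∀ x y, P x → P y → P (x * y)) (inv : ∀ x, P x → P x⁻¹) (f : FreeProd A J) :
    P f := by
  induction f using Monoid.Coprod.induction_on with
  | inl m =>
    induction m using Monoid.CoprodI.induction_on with
    | one => simpa using one
    | of i a => exact hf i a
    | mul x y hx hy => simpa using mul _ _ hx hy
  | inr n =>
    induction n using FreeGroup.induction_on with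
    | C1 => simpa using one
    | of j => exact hg j
    | inv_of j _ => simpa [gen] using inv _ (hg j)
    | mul x y hx hy => simpa using mul _ _ hx hy
  | mul x y hx hy => exact mul x y hx hy

theorem foxHom_eq (k : I ⊕ J) (f : FreeProd A J) : ∃ x, foxHom k f = triUnit f x := by
  classical
  have h1 : triUnit (1 : FreeProd A J) 0 = 1 := by
    ext1
    simp [triUnit, Matrix.one_fin_two, ← MonoidAlgebra.one_def]
  induction f using freeProd_induction with
  | one => exact ⟨0, by rw [map_one, h1]⟩
  | hf i a => exact ⟨_, foxHom_factor k i a⟩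
  | hg j => exact ⟨_, foxHom_gen k j⟩
  | mul f g hf hg =>
    obtain ⟨x, hx⟩ := hf
    obtain ⟨y, hy⟩ := hg
    exact ⟨_, by rw [map_mul, hx, hy, triUnit_mul]⟩
  | inv f hf =>
    obtain ⟨x, hx⟩ := hf
    refine ⟨-(x * grp f⁻¹), ?_⟩
    rw [map_inv, hx, inv_eq_iff_mul_eq_one, triUnit_mul, mul_inv_cancel, add_neg_cancel, h1]

theorem foxMatrix (k : I ⊕ J) (u : GroupRing A J) :
    MonoidAlgebra.lift ℤ (Matrix (Fin 2) (Fin 2) (GroupRing A J)) (FreeProd A J)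
      ((Units.coeHom _).comp (foxHom k)) u = !![aug u • 1, foxDeriv k u; 0, u] := by
  have h : ∀ u : GroupRing A J,
      (MonoidAlgebra.lift ℤ (Matrix (Fin 2) (Fin 2) (GroupRing A J)) (FreeProd A J)
        ((Units.coeHom _).comp (foxHom k)) u) 0 0 = aug u • 1 ∧
      (MonoidAlgebra.lift ℤ (Matrix (Fin 2) (Fin 2) (GroupRing A J)) (FreeProd A J)
        ((Units.coeHom _).comp (foxHom k)) u) 1 0 = 0 ∧
      (MonoidAlgebra.lift ℤ (Matrix (Fin 2) (Fin 2) (GroupRing A J)) (FreeProd A J)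
        ((Units.coeHom _).comp (foxHom k)) u) 1 1 = u := by
    intro u
    induction u using MonoidAlgebra.induction_on with
    | of f =>
      obtain ⟨x, hx⟩ := foxHom_eq k f
      rw [MonoidAlgebra.lift_of, aug, MonoidAlgebra.lift_of]
      simp only [MonoidHom.comp_apply, hx]
      simp [triUnit]
    | add u v hu hv =>
      simp only [map_add, Matrix.add_apply, hu, hv, add_smul]
      simp
    | smul r u hu =>
      simp only [map_smul, Matrix.smul_apply, hu, smul_assoc]
      simp
  obtain ⟨h0, h1, h2⟩ := h u
  ext1 i j
  fin_cases i <;> fin_cases j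
  · exact h0
  · rfl
  · exact h1
  · exact h2

/-- `D_k` is the Fox derivative. -/
theorem isFoxDerivative_foxDeriv (k : I ⊕ J) :
    IsFoxDerivative k (foxDeriv (A := A) k) where
  isDerivation :=
    { add := fun u v => by simp [foxDeriv]
      mul := fun u v => by
        have h := congrFun (congrFun (map_mul (MonoidAlgebra.lift ℤ
          (Matrix (Fin 2) (Fin 2) (GroupRing A J)) (FreeProd A J)
          ((Units.coeHom _).comp (foxHom k))) u v) 0) 1
        rw [foxMatrix, foxMatrix, foxMatrix, Matrix.mul_fin_two] at h
        simpa [add_comm] using h }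
  gen := fun j => by
    classical
    rw [foxDeriv, MonoidAlgebra.lift_of]
    simp only [MonoidHom.comp_apply, foxHom_gen]
    simp [triUnit]
  factor := fun i a => by
    classical
    rw [foxDeriv, MonoidAlgebra.lift_of]
    simp only [MonoidHom.comp_apply, foxHom_factor]
    simp [triUnit]

/-- The Fox derivative is uniquely determined by its defining conditions. -/
theorem IsFoxDerivative.unique {k : I ⊕ J} {d d' : GroupRing A J → GroupRing A J}
    (h : IsFoxDerivative k d) (h' : IsFoxDerivative k d') : d = d' := by
  classical
  have aug_grp : ∀ f : FreeProd A J, aug (grp f) = 1 := fun f => by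
    rw [aug, MonoidAlgebra.lift_of]
    rfl
  have mul_grp : ∀ {d : GroupRing A J → GroupRing A J}, IsFoxDerivative k d →
      ∀ f g : FreeProd A J, d (grp (f * g)) = d (grp f) * grp g + d (grp g) := by
    intro d h f g
    rw [grp, map_mul, h.isDerivation.mul, aug_grp, one_smul]
  have one_grp : ∀ {d : GroupRing A J → GroupRing A J}, IsFoxDerivative k d →
      d (grp 1) = 0 := by
    intro d h
    have := mul_grp h 1 1
    rw [mul_one, grp, map_one, mul_one] at this
    rw [grp, map_one]
    exact left_eq_add.mp this
  have key : ∀ f : FreeProd A J, d (grp f) = d' (grp f) := by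
    intro f
    induction f using freeProd_induction with
    | one => rw [one_grp h, one_grp h']
    | hf i a => rw [h.factor, h'.factor]
    | hg j => rw [h.gen, h'.gen]
    | mul f g hf hg => rw [mul_grp h, mul_grp h', hf, hg]
    | inv f hf =>
      have e := mul_grp h f f⁻¹
      have e' := mul_grp h' f f⁻¹
      rw [mul_inv_cancel, one_grp h, hf] at e
      rw [mul_inv_cancel, one_grp h'] at e'
      exact add_left_cancel (e.symm.trans e')
  have smul : ∀ {d : GroupRing A J → GroupRing A J}, IsFoxDerivative k d →
      ∀ (r : ℤ) u, d (r • u) = r • d u := fun h r u =>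
    map_zsmul (AddMonoidHom.mk' _ h.isDerivation.add) r u
  funext u
  induction u using MonoidAlgebra.induction_on with
  | of f => exact key f
  | add u v hu hv => rw [h.isDerivation.add, h'.isDerivation.add, hu, hv]
  | smul r u hu => rw [smul h, smul h', hu]

variable (N : Subgroup (FreeProd A J))

/-- The left ideal `ℤ[F] · (N - 1)`: all sums of products `c * (n - 1)` with `c` in `ℤ[F]` and
`n` in `N`. (`Ideal` means left ideal.) -/
noncomputable def relIdeal : Ideal (GroupRing A J) :=
  Ideal.span {x | ∃ n ∈ N, x = grp n - 1}

/-- The subgroup `F_K` generated by the `g j` with `j ∈ K` and the `A i` with `i ∈ K`. -/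
def subProd (K : Set (I ⊕ J)) : Subgroup (FreeProd A J) :=
  Subgroup.closure
    ({f | ∃ j, Sum.inr j ∈ K ∧ f = gen A j} ∪
      {f | ∃ i, Sum.inl i ∈ K ∧ ∃ a : A i, f = factor A i a})

/-- The subgroup `M`: the product of the subgroup generated by the normal closures
`(N ∩ A i)^F`, `i ∈ I`, and of `[N, N]`. For a normal subgroup `N` both are normal, so that
their product set is their join. -/
def relM : Subgroup (FreeProd A J) :=
  (⨆ i : I, Subgroup.normalClosure
    ((N ⊓ (factor (J := J) A i).range : Subgroup (FreeProd A J)) : Set (FreeProd A J))) ⊔ ⁅N, N⁆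

end FoxCalculus

/-! Let R = (F_K ∩ N)^F M. For the forward direction, pass to E = F/R: there the image B of N is
normal and abelian, and meets the images of F_K and of every A_i trivially. Test v - 1 = ∑ D_i(v) +
∑ (g_j - 1) D_j(v) against functions p on E, extended linearly, that are left invariant under F_K
and satisfy p(eb) = p(e) + χ(b) for b in B.

Every summand is killed. For k ∈ K this is left invariance, since D_i(v) lies in the right ideal
generated by the a - 1 with a ∈ A_i. For j ∉ K, p(y x) = ε(y) q when x ∈ ℤ[F](N - 1), and ε(g_j - 1)
= 0. For i ∉ K, D_i(v) vanishes in both ℤ[A_i \ E] and ℤ[E / B], and p is a sum of functions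
factoring through these two quotients (`intLift_eq_zero_of_disjoint`). Hence p(v) = p(1)
(`eq_of_foxDeriv_mem`).

As F_K × B acts freely on E, one such p records the double coset and the B-part of e; equality at v
and 1 puts the image of v in that of F_K (`mem_map_subProd_of_foxDeriv_mem`).

Conversely, for k ∉ K the elements of N with D_k ≡ 0 form a normal subgroup `foxKer` containing R,
and D_k vanishes on F_K. -/

/-! ### Linear extension of maps to monoid rings -/

/-- The `ℤ`-linear extension of a map `M → Q` to the integral monoid ring of `M`. -/
noncomputable def MonoidAlgebra.intLift {M Q : Type*} [Monoid M] [AddCommGroup Q] (f : M → Q) :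
    MonoidAlgebra ℤ M →ₗ[ℤ] Q :=
  Finsupp.linearCombination ℤ f ∘ₗ (MonoidAlgebra.coeffLinearEquiv ℤ).toLinearMap

namespace MonoidAlgebra

variable {M E Q : Type*} [Monoid M] [AddCommGroup Q]

theorem intLift_of (f : M → Q) (m : M) : intLift f (of ℤ M m) = f m := by
  simp [intLift, coeffLinearEquiv]

theorem intLift_add (f g : M → Q) (x : MonoidAlgebra ℤ M) :
    intLift (fun m => f m + g m) x = intLift f x + intLift g x := by
  induction x using MonoidAlgebra.induction_on with
  | of m => simp only [intLift_of]
  | add x y hx hy => rw [map_add, hx, hy, map_add, map_add]; abel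
  | smul r x hx => rw [map_smul, hx, map_smul, map_smul, smul_add]

theorem intLift_neg (f : M → Q) (x : MonoidAlgebra ℤ M) :
    intLift (fun m => -f m) x = -intLift f x := by
  induction x using MonoidAlgebra.induction_on with
  | of m => simp only [intLift_of]
  | add x y hx hy => rw [map_add, hx, hy, map_add]; abel
  | smul r x hx => rw [map_smul, hx, map_smul, smul_neg]

/-- The extension of f ∘ p factors through the free abelian group on E. -/
theorem intLift_comp_eq_zero (p : M → E) (f : E → Q) {x : MonoidAlgebra ℤ M}
    (h : intLift (fun m => Finsupp.single (p m) (1 : ℤ)) x = 0) :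
    intLift (fun m => f (p m)) x = 0 := by
  have : ∀ x : MonoidAlgebra ℤ M, intLift (fun m => f (p m)) x =
      Finsupp.linearCombination ℤ f (intLift (fun m => Finsupp.single (p m) (1 : ℤ)) x) := by
    intro x
    induction x using MonoidAlgebra.induction_on with
    | of m => rw [intLift_of, intLift_of, Finsupp.linearCombination_single, one_smul]
    | add x y hx hy => rw [map_add, hx, hy, map_add, map_add]
    | smul r x hx => rw [map_smul, hx, map_smul, map_smul]
  rw [this, h, map_zero]

theorem intLift_of_mul {f : M → Q} {a : M} (h : ∀ m, f (a * m) = f m) (x : MonoidAlgebra ℤ M) :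
    intLift f (of ℤ M a * x) = intLift f x := by
  induction x using MonoidAlgebra.induction_on with
  | of m => rw [← map_mul, intLift_of, intLift_of, h]
  | add x y hx hy => rw [mul_add, map_add, hx, hy, map_add]
  | smul r x hx => rw [mul_smul_comm, map_smul, hx, map_smul]

end MonoidAlgebra

/-! ### Double cosets and affine functions -/

/-- Two disjoint subgroups, the second one normal, act freely from the left and from the right,
so that the `A`-part and the `B`-part of an element can be chosen equivariantly. -/
theorem Subgroup.exists_equivariant_parts {E : Type*} [Group E] (A B : Subgroup E) [B.Normal]
    (h : Disjoint A B) : ∃ α β : E → E, (∀ e, α e ∈ A) ∧ (∀ e, β e ∈ B) ∧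
      (∀ a ∈ A, ∀ b ∈ B, ∀ e, α (a * e * b) = a * α e) ∧
      (∀ a ∈ A, ∀ b ∈ B, ∀ e, β (a * e * b) = β e * b) := by
  let q : E → DoubleCoset.Quotient (A : Set E) (B : Set E) := DoubleCoset.mk A B
  have hq : ∀ e, ∃ a ∈ A, ∃ b ∈ B, e = a * (q e).out * b := fun e => by
    have := DoubleCoset.out_eq' A B (q e)
    exact (DoubleCoset.eq A B _ _).1 this
  choose α hα β hβ he using hq
  -- Freeness: normality of B places a'⁻¹a = t(b'b⁻¹)t⁻¹ in A ∩ B = 1.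
  have uniq : ∀ t : E, ∀ a ∈ A, ∀ b ∈ B, ∀ a' ∈ A, ∀ b' ∈ B, a * t * b = a' * t * b' →
      a = a' ∧ b = b' := by
    intro t a ha b hb a' ha' b' hb' e
    have h1 : a'⁻¹ * a = t * (b' * b⁻¹) * t⁻¹ := by
      have : a * t = a' * t * b' * b⁻¹ := by rw [← e]; group
      calc a'⁻¹ * a = a'⁻¹ * (a * t) * t⁻¹ := by group
        _ = _ := by rw [this]; group
    have h2 : a'⁻¹ * a = 1 := Subgroup.disjoint_def.1 h (A.mul_mem (A.inv_mem ha') ha) <| by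
      rw [h1]
      exact Subgroup.Normal.conj_mem ‹_› _ (B.mul_mem hb' (B.inv_mem hb)) t
    have h3 : a = a' := (inv_mul_eq_one.1 h2).symm
    subst h3
    exact ⟨rfl, mul_left_cancel e⟩
  have key : ∀ a ∈ A, ∀ b ∈ B, ∀ e, α (a * e * b) = a * α e ∧ β (a * e * b) = β e * b := by
    intro a ha b hb e
    have hqe : q (a * e * b) = q e := ((DoubleCoset.eq A B _ _).2 ⟨a, ha, b, hb, rfl⟩).symm
    refine uniq (q e).out _ (hα _) _ (hβ _) _ (A.mul_mem ha (hα e)) _ (B.mul_mem (hβ e) hb) ?_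
    have h1 := he (a * e * b)
    rw [hqe] at h1
    rw [← h1]
    conv_lhs => rw [he e]
    simp only [mul_assoc]
  exact ⟨α, β, hα, hβ, fun a ha b hb e => (key a ha b hb e).1,
    fun a ha b hb e => (key a ha b hb e).2⟩

open MonoidAlgebra in
/-- An element of the integral group ring of `F` that vanishes in `ℤ[A \ E]` and in `ℤ[E / B]`
is killed by all maps on `E` that are affine for the right translations by `B`. -/
theorem MonoidAlgebra.intLift_eq_zero_of_disjoint {F E Q : Type*} [Monoid F] [Group E]
    [AddCommGroup Q] {A B : Subgroup E} [B.Normal] (h : Disjoint A B) (φ : F → E)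
    {f : E → Q} {χ : E → Q} (hf : ∀ e, ∀ b ∈ B, f (e * b) = f e + χ b) {x : MonoidAlgebra ℤ F}
    (hA : ∀ p : E → E, (∀ a ∈ A, ∀ e, p (a * e) = p e) →
      intLift (fun m => Finsupp.single (p (φ m)) (1 : ℤ)) x = 0)
    (hB : ∀ p : E → E, (∀ b ∈ B, ∀ e, p (e * b) = p e) →
      intLift (fun m => Finsupp.single (p (φ m)) (1 : ℤ)) x = 0) :
    intLift (fun m => f (φ m)) x = 0 := by
  obtain ⟨α, β, hα, hβ, hα', hβ'⟩ := A.exists_equivariant_parts B h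
  have pA := hA (fun e => (α e)⁻¹ * e) fun a ha e => by
    have := hα' a ha 1 B.one_mem e
    rw [mul_one] at this
    simp only [this]
    group
  have pB := hB (fun e => e * (β e)⁻¹) fun b hb e => by
    have := hβ' 1 A.one_mem b hb e
    rw [one_mul] at this
    simp only [this]
    group
  -- With e = φ m, the last two terms give χ(β e) = f(α(e)⁻¹e) - f(α(e)⁻¹e β(e)⁻¹). The first and
  -- third terms depend only on eB and the second only on Ae; writing α(e) as α(e β(e)⁻¹) makes this
  -- visible for the third.
  have e : ∀ m, f (φ m) = f (φ m * (β (φ m))⁻¹) + (f ((α (φ m))⁻¹ * φ m) +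
      -f ((α (φ m * (β (φ m))⁻¹))⁻¹ * (φ m * (β (φ m))⁻¹))) := by
    intro m
    have h1 := hf (φ m * (β (φ m))⁻¹) _ (hβ (φ m))
    have h2 : α (φ m * (β (φ m))⁻¹) = α (φ m) := by
      have := hα' 1 A.one_mem _ (B.inv_mem (hβ (φ m))) (φ m)
      rwa [one_mul, one_mul] at this
    have h3 := hf ((α (φ m))⁻¹ * φ m * (β (φ m))⁻¹) _ (hβ (φ m))
    rw [inv_mul_cancel_right] at h1 h3
    rw [h1, h2, h3, mul_assoc]
    abel
  rw [funext e, intLift_add, intLift_add, intLift_neg,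
    intLift_comp_eq_zero (fun m => φ m * (β (φ m))⁻¹) f pB,
    intLift_comp_eq_zero (fun m => (α (φ m))⁻¹ * φ m) f pA,
    intLift_comp_eq_zero (fun m => φ m * (β (φ m))⁻¹) (fun e => f ((α e)⁻¹ * e)) pB]
  simp

open scoped commutatorElement

theorem Subgroup.iSup_normal_of_normal {G : Type*} [Group G] {ι : Sort*} (H : ι → Subgroup G)
    (h : ∀ i, (H i).Normal) : (⨆ i, H i).Normal where
  conj_mem n hn g := by
    induction hn using Subgroup.iSup_induction' with
    | hp i x hx => exact Subgroup.mem_iSup_of_mem i ((h i).conj_mem x hx g)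
    | h1 => simp
    | hmul x y _ _ hx hy => simpa [mul_assoc] using Subgroup.mul_mem _ hx hy

/-! ### Fox derivatives of group elements and the fundamental formula -/

namespace FoxCalculus

universe u v w

variable {I : Type u} {A : I → Type v} [∀ i, Group (A i)] {J : Type w}

theorem aug_grp (f : FreeProd A J) : aug (grp f) = 1 := by
  rw [aug, MonoidAlgebra.lift_of]
  rfl

theorem foxDeriv_grp_mul (k : I ⊕ J) (f g : FreeProd A J) :
    foxDeriv k (grp (f * g)) = foxDeriv k (grp f) * grp g + foxDeriv k (grp g) := by
  rw [grp, map_mul, (isFoxDerivative_foxDeriv k).isDerivation.mul, aug_grp, one_smul]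

theorem foxDeriv_grp_one (k : I ⊕ J) : foxDeriv k (grp (1 : FreeProd A J)) = 0 := by
  have := foxDeriv_grp_mul k (1 : FreeProd A J) 1
  rw [mul_one, grp, map_one, mul_one] at this
  rw [grp, map_one]
  exact left_eq_add.mp this

theorem foxDeriv_grp_inv (k : I ⊕ J) (f : FreeProd A J) :
    foxDeriv k (grp f⁻¹) = -(foxDeriv k (grp f) * grp f⁻¹) := by
  have := foxDeriv_grp_mul k f f⁻¹
  rw [mul_inv_cancel, foxDeriv_grp_one] at this
  exact (neg_eq_of_add_eq_zero_right this.symm).symm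

/-- The summand with index `k` in the fundamental formula of the Fox calculus. -/
noncomputable def foxTerm (f : FreeProd A J) : I ⊕ J → GroupRing A J
  | Sum.inl i => foxDeriv (Sum.inl i) (grp f)
  | Sum.inr j => (grp (gen A j) - 1) * foxDeriv (Sum.inr j) (grp f)

theorem foxTerm_mul (f g : FreeProd A J) (k : I ⊕ J) :
    foxTerm (f * g) k = foxTerm f k * grp g + foxTerm g k := by
  cases k with
  | inl i => exact foxDeriv_grp_mul _ f g
  | inr j => rw [foxTerm, foxDeriv_grp_mul, mul_add, ← mul_assoc]; rfl

theorem foxTerm_one (k : I ⊕ J) : foxTerm (1 : FreeProd A J) k = 0 := by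
  cases k with
  | inl i => exact foxDeriv_grp_one _
  | inr j => rw [foxTerm, foxDeriv_grp_one, mul_zero]

theorem foxTerm_inv (f : FreeProd A J) (k : I ⊕ J) :
    foxTerm f⁻¹ k = -(foxTerm f k * grp f⁻¹) := by
  have := foxTerm_mul f f⁻¹ k
  rw [mul_inv_cancel, foxTerm_one] at this
  exact (neg_eq_of_add_eq_zero_right this.symm).symm

/-- The fundamental formula of the Fox calculus. -/
theorem exists_sum_foxTerm (f : FreeProd A J) :
    ∃ S : Finset (I ⊕ J), ∀ T, S ⊆ T → ∑ k ∈ T, foxTerm f k = grp f - 1 := by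
  classical
  induction f using freeProd_induction with
  | one => exact ⟨∅, fun T _ => by simp only [foxTerm_one, grp, map_one]; simp⟩
  | hf i a =>
    refine ⟨{Sum.inl i}, fun T hT => ?_⟩
    rw [Finset.sum_eq_single_of_mem (Sum.inl i) (hT (Finset.mem_singleton_self _))]
    · rw [foxTerm, (isFoxDerivative_foxDeriv _).factor, if_pos rfl]
    · rintro (i' | j) _ hne
      · rw [foxTerm, (isFoxDerivative_foxDeriv _).factor, if_neg hne]
      · rw [foxTerm, (isFoxDerivative_foxDeriv _).factor, if_neg hne, mul_zero]
  | hg j =>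
    refine ⟨{Sum.inr j}, fun T hT => ?_⟩
    rw [Finset.sum_eq_single_of_mem (Sum.inr j) (hT (Finset.mem_singleton_self _))]
    · rw [foxTerm, (isFoxDerivative_foxDeriv _).gen, if_pos rfl, mul_one]
    · rintro (i | j') _ hne
      · rw [foxTerm, (isFoxDerivative_foxDeriv _).gen, if_neg hne]
      · rw [foxTerm, (isFoxDerivative_foxDeriv _).gen, if_neg hne, mul_zero]
  | mul f g hf hg =>
    obtain ⟨S, hS⟩ := hf
    obtain ⟨S', hS'⟩ := hg
    -- Allowing every larger T lets both formulas be summed over the same set.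
    refine ⟨S ∪ S', fun T hT => ?_⟩
    simp only [foxTerm_mul]
    rw [Finset.sum_add_distrib, ← Finset.sum_mul, hS T (Finset.union_subset_left hT),
      hS' T (Finset.union_subset_right hT), sub_mul, one_mul, ← map_mul]
    abel
  | inv f hf =>
    obtain ⟨S, hS⟩ := hf
    refine ⟨S, fun T hT => ?_⟩
    simp only [foxTerm_inv]
    rw [Finset.sum_neg_distrib, ← Finset.sum_mul, hS T hT, sub_mul, one_mul, ← map_mul,
      mul_inv_cancel, map_one]
    abel

/-! ### Testing Fox derivatives against affine functions -/

variable {Q : Type*} [AddCommGroup Q]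

open MonoidAlgebra in
/-- `D_i` takes values in the right ideal generated by the augmentation ideal of `A i`. -/
theorem intLift_foxDeriv_inl (i : I) {p : FreeProd A J → Q}
    (hp : ∀ a f, p (factor A i a * f) = p f) (f : FreeProd A J) :
    intLift p (foxDeriv (Sum.inl i) (grp f)) = 0 := by
  classical
  -- The arbitrary right factor x absorbs the g in D(fg) = D(f)g + D(g).
  suffices h : ∀ x, intLift p (foxDeriv (Sum.inl i) (grp f) * x) = 0 by
    simpa only [mul_one] using h 1
  induction f using freeProd_induction with
  | one => intro x; rw [foxDeriv_grp_one, zero_mul, map_zero]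
  | hf i' a =>
    intro x
    rw [(isFoxDerivative_foxDeriv _).factor]
    split_ifs with h
    · obtain rfl := Sum.inl_injective h
      rw [sub_mul, one_mul, map_sub, intLift_of_mul (hp a), sub_self]
    · rw [zero_mul, map_zero]
  | hg j =>
    intro x
    rw [(isFoxDerivative_foxDeriv _).gen, if_neg Sum.inl_ne_inr, zero_mul, map_zero]
  | mul f g hf hg =>
    intro x
    rw [foxDeriv_grp_mul, add_mul, map_add, mul_assoc, hf, hg, add_zero]
  | inv f hf =>
    intro x
    rw [foxDeriv_grp_inv, neg_mul, map_neg, mul_assoc, hf, neg_zero]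

variable (N : Subgroup (FreeProd A J))

-- The value of p on f(n - 1) is χ(n) for every f, so a left factor acts only through its
-- augmentation.
open MonoidAlgebra in
theorem exists_intLift_mul_relIdeal {p χ : FreeProd A J → Q} {W : Submodule ℤ Q}
    (hp : ∀ f, ∀ n ∈ N, p (f * n) = p f + χ n) (hχ : ∀ n ∈ N, χ n ∈ W) {x : GroupRing A J}
    (hx : x ∈ relIdeal N) : ∃ q ∈ W, ∀ y, intLift p (y * x) = aug y • q := by
  induction hx using Submodule.span_induction with
  | mem x hx =>
    obtain ⟨n, hn, rfl⟩ := hx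
    refine ⟨χ n, hχ n hn, fun y => ?_⟩
    induction y using MonoidAlgebra.induction_on with
    | of f =>
      rw [mul_sub, mul_one, ← map_mul, map_sub, intLift_of, intLift_of, hp f n hn, aug_grp,
        add_sub_cancel_left, one_smul]
    | add y z hy hz => rw [add_mul, map_add, hy, hz, map_add, add_smul]
    | smul r y hy => rw [smul_mul_assoc, map_smul, hy, map_smul, smul_assoc]
  | zero => exact ⟨0, W.zero_mem, fun y => by simp⟩
  | add x z _ _ hx hz =>
    obtain ⟨q, hq, h⟩ := hx
    obtain ⟨q', hq', h'⟩ := hz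
    exact ⟨q + q', W.add_mem hq hq', fun y => by rw [mul_add, map_add, h, h', smul_add]⟩
  | smul a x _ hx =>
    obtain ⟨q, hq, h⟩ := hx
    exact ⟨aug a • q, W.smul_mem _ hq, fun y => by
      rw [smul_eq_mul, ← mul_assoc, h, map_mul, mul_smul]⟩

variable {N} in
open MonoidAlgebra in
theorem intLift_relIdeal_eq_zero {p : FreeProd A J → Q} (hp : ∀ f, ∀ n ∈ N, p (f * n) = p f)
    {x : GroupRing A J} (hx : x ∈ relIdeal N) : intLift p x = 0 := by
  obtain ⟨q, hq, h⟩ := exists_intLift_mul_relIdeal N (p := p) (χ := 0)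
    (W := ⊥) (fun f n hn => by rw [hp f n hn, Pi.zero_apply, add_zero]) (fun n _ => Submodule.zero_mem _) hx
  rw [Submodule.mem_bot] at hq
  simpa [hq] using h 1

open MonoidAlgebra in
/-- A map on a quotient `E` of `F` that is invariant under `F_K` and affine under the image of `N`
takes the same value at `v` and at `1` if the Fox derivatives of `v` outside of `K` vanish
modulo `N`. -/
theorem eq_of_foxDeriv_mem {E : Type*} [Group E] (π : FreeProd A J →* E)
    [(N.map π).Normal] (hN : ∀ i, Disjoint ((factor A i).range.map π) (N.map π))
    {K : Set (I ⊕ J)} {v : FreeProd A J}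
    (hv : ∀ k : I ⊕ J, k ∉ K → foxDeriv k (grp v) ∈ relIdeal N) {p χ : E → Q}
    (hp : ∀ f ∈ subProd K, ∀ e, p (π f * e) = p e)
    (hχ : ∀ e, ∀ b ∈ N.map π, p (e * b) = p e + χ b) : p (π v) = p 1 := by
  have term : ∀ k, intLift (fun f => p (π f)) (foxTerm v k) = 0 := by
    intro k
    by_cases hk : k ∈ K
    · cases k with
      | inl i =>
        refine intLift_foxDeriv_inl i (fun a f => ?_) v
        rw [map_mul]
        exact hp _ (Subgroup.subset_closure (Or.inr ⟨i, hk, a, rfl⟩)) _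
      | inr j =>
        rw [foxTerm, sub_mul, one_mul, map_sub, intLift_of_mul, sub_self]
        intro f
        rw [map_mul]
        exact hp _ (Subgroup.subset_closure (Or.inl ⟨j, hk, rfl⟩)) _
    · cases k with
      | inl i =>
        refine intLift_eq_zero_of_disjoint (hN i) π hχ (fun q hq => ?_) (fun q hq => ?_)
        · refine intLift_foxDeriv_inl i (fun a f => ?_) v
          rw [map_mul, hq _ ⟨_, ⟨a, rfl⟩, rfl⟩]
        · refine intLift_relIdeal_eq_zero (fun f n hn => ?_) (hv _ hk)
          rw [map_mul, hq _ ⟨n, hn, rfl⟩]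
      | inr j =>
        obtain ⟨q, -, h⟩ := exists_intLift_mul_relIdeal N (p := fun f => p (π f))
          (χ := fun f => χ (π f)) (W := ⊤)
          (fun f n hn => by rw [map_mul, hχ _ _ ⟨n, hn, rfl⟩]) (fun _ _ => trivial) (hv _ hk)
        rw [foxTerm, h, map_sub, map_one, aug_grp, sub_self, zero_smul]
  obtain ⟨S, hS⟩ := exists_sum_foxTerm v
  have h := congrArg (intLift fun f => p (π f)) (hS S subset_rfl)
  rw [map_sum, Finset.sum_eq_zero fun k _ => term k, map_sub, intLift_of,
    ← map_one (MonoidAlgebra.of ℤ (FreeProd A J)), intLift_of, map_one] at h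
  exact (sub_eq_zero.1 h.symm)

open scoped IsMulCommutative in
/-- If `N` has trivial image intersections with `F_K` and the `A i` and abelian image, then
the vanishing of the Fox derivatives outside of `K` modulo `N` is detected by `F_K`. -/
theorem mem_map_subProd_of_foxDeriv_mem {E : Type*} [Group E] (π : FreeProd A J →* E)
    [(N.map π).Normal] [IsMulCommutative (N.map π)]
    (hN : ∀ i, Disjoint ((factor A i).range.map π) (N.map π)) {K : Set (I ⊕ J)}
    (hK : Disjoint ((subProd K).map π) (N.map π)) {v : FreeProd A J}
    (hv : ∀ k : I ⊕ J, k ∉ K → foxDeriv k (grp v) ∈ relIdeal N) :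
    π v ∈ (subProd K).map π := by
  classical
  obtain ⟨α, β, hα, hβ, hα', hβ'⟩ := Subgroup.exists_equivariant_parts _ _ hK
  -- The first coordinate of p marks the representative of the double coset of e, the second is the
  -- N-part of e. The value 0 of χ off the image of N is only a filler.
  have key := eq_of_foxDeriv_mem (Q := (E →₀ ℤ) × Additive (N.map π)) N π hN hv
    (p := fun e => (Finsupp.single ((α e)⁻¹ * e * (β e)⁻¹) 1, Additive.ofMul ⟨β e, hβ e⟩))
    (χ := fun e => (0, if h : e ∈ N.map π then Additive.ofMul ⟨e, h⟩ else 0))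
    (fun f hf e => by
      have h1 := hα' _ ⟨f, hf, rfl⟩ 1 (Subgroup.one_mem _) e
      have h2 := hβ' _ ⟨f, hf, rfl⟩ 1 (Subgroup.one_mem _) e
      rw [mul_one] at h1
      rw [mul_one, mul_one] at h2
      simp only [h1, h2]
      congr 2
      group)
    (fun e b hb => by
      have h1 := hα' 1 (Subgroup.one_mem _) b hb e
      have h2 := hβ' 1 (Subgroup.one_mem _) b hb e
      rw [one_mul, one_mul] at h1
      rw [one_mul] at h2
      simp only [h1, h2, dif_pos hb, Prod.mk_add_mk, add_zero]
      congr 2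
      group)
  obtain ⟨h1, h2⟩ := Prod.ext_iff.1 key
  have h3 : β (π v) = β 1 := congrArg Subtype.val (Additive.ofMul.injective h2)
  have h4 := Finsupp.single_left_injective one_ne_zero h1
  simp only [h3, mul_one] at h4
  have h5 : π v = α (π v) * (α 1)⁻¹ := by
    rw [mul_left_inj, inv_mul_eq_iff_eq_mul] at h4
    exact h4
  rw [h5]
  exact Subgroup.mul_mem _ (hα _) (Subgroup.inv_mem _ (hα 1))

/-! ### Elements of N with vanishing Fox derivative modulo N -/

section Converse

/-- Normality makes the left ideal two-sided: (n - 1)f = f(f⁻¹nf - 1). -/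
theorem mul_grp_mem_relIdeal [N.Normal] {x : GroupRing A J} (hx : x ∈ relIdeal N) (f : FreeProd A J) :
    x * grp f ∈ relIdeal N := by
  induction hx using Submodule.span_induction with
  | mem x hx =>
    obtain ⟨n, hn, rfl⟩ := hx
    have : (grp n - 1) * grp f = grp f * (grp (f⁻¹ * n * f) - 1) := by
      rw [sub_mul, mul_sub, ← map_mul, ← map_mul, one_mul, mul_one]
      congr 2
      group
    rw [this]
    refine Ideal.mul_mem_left _ _ (Ideal.subset_span ⟨_, ?_, rfl⟩)
    simpa using Subgroup.Normal.conj_mem ‹N.Normal› n hn f⁻¹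
  | zero => simp
  | add x z _ _ hx hz => rw [add_mul]; exact add_mem hx hz
  | smul a x _ hx => rw [smul_eq_mul, mul_assoc]; exact Ideal.mul_mem_left _ _ hx

theorem mul_grp_sub_self_mem_relIdeal (x : GroupRing A J) {n : FreeProd A J} (hn : n ∈ N) :
    x * grp n - x ∈ relIdeal N := by
  have : x * grp n - x = x * (grp n - 1) := by rw [mul_sub, mul_one]
  rw [this]
  exact Ideal.mul_mem_left _ _ (Ideal.subset_span ⟨n, hn, rfl⟩)

variable [N.Normal]

/-- The elements of `N` whose Fox derivative with index `k` vanishes modulo `N`. -/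
def foxKer (k : I ⊕ J) : Subgroup (FreeProd A J) where
  carrier := {n | n ∈ N ∧ foxDeriv k (grp n) ∈ relIdeal N}
  one_mem' := ⟨N.one_mem, by rw [foxDeriv_grp_one]; exact zero_mem _⟩
  mul_mem' := fun ⟨ha, ha'⟩ ⟨hb, hb'⟩ => ⟨N.mul_mem ha hb, by
    rw [foxDeriv_grp_mul]
    exact add_mem (mul_grp_mem_relIdeal N ha' _) hb'⟩
  inv_mem' := fun ⟨ha, ha'⟩ => ⟨N.inv_mem ha, by
    rw [foxDeriv_grp_inv]
    exact neg_mem (mul_grp_mem_relIdeal N ha' _)⟩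

instance foxKer_normal (k : I ⊕ J) : (foxKer N k).Normal where
  conj_mem n hn f := by
    refine ⟨Subgroup.Normal.conj_mem ‹_› n hn.1 f, ?_⟩
    have : foxDeriv k (grp (f * n * f⁻¹)) =
        (foxDeriv k (grp f) * grp n - foxDeriv k (grp f) + foxDeriv k (grp n)) * grp f⁻¹ := by
      rw [foxDeriv_grp_mul, foxDeriv_grp_mul, foxDeriv_grp_inv, add_mul, add_mul, sub_mul]
      abel
    rw [this]
    exact mul_grp_mem_relIdeal N (add_mem (mul_grp_sub_self_mem_relIdeal N _ hn.1) hn.2) _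

/-- Modulo N, right multiplication by elements of N is trivial, so D_k is additive on N and D_k(ab)
≡ D_k(ba). -/
theorem commutator_le_foxKer (k : I ⊕ J) : ⁅N, N⁆ ≤ foxKer N k := by
  rw [Subgroup.commutator_le]
  intro a ha b hb
  refine ⟨N.mul_mem (N.mul_mem (N.mul_mem ha hb) (N.inv_mem ha)) (N.inv_mem hb), ?_⟩
  have h : foxDeriv k (grp (a * b)) - foxDeriv k (grp (b * a)) ∈ relIdeal N := by
    rw [foxDeriv_grp_mul, foxDeriv_grp_mul]
    have := sub_mem (mul_grp_sub_self_mem_relIdeal N (foxDeriv k (grp a)) hb)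
      (mul_grp_sub_self_mem_relIdeal N (foxDeriv k (grp b)) ha)
    convert this using 1
    abel
  have e : foxDeriv k (grp ⁅a, b⁆) =
      (foxDeriv k (grp (a * b)) - foxDeriv k (grp (b * a))) * grp (b * a)⁻¹ := by
    have : ⁅a, b⁆ = (a * b) * (b * a)⁻¹ := by rw [commutatorElement_def]; group
    rw [this, foxDeriv_grp_mul, foxDeriv_grp_inv k (b * a), sub_mul]
    abel
  rw [e]
  exact mul_grp_mem_relIdeal N h _

theorem foxDeriv_grp_eq_zero {K : Set (I ⊕ J)} {k : I ⊕ J} (hk : k ∉ K) {f : FreeProd A J}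
    (hf : f ∈ subProd K) : foxDeriv k (grp f) = 0 := by
  classical
  induction hf using Subgroup.closure_induction with
  | mem x hx =>
    obtain ⟨j, hj, rfl⟩ | ⟨i, hi, a, rfl⟩ := hx
    · rw [(isFoxDerivative_foxDeriv _).gen, if_neg]
      rintro rfl
      exact hk hj
    · rw [(isFoxDerivative_foxDeriv _).factor, if_neg]
      rintro rfl
      exact hk hi
  | one => exact foxDeriv_grp_one k
  | mul x y _ _ hx hy => rw [foxDeriv_grp_mul, hx, hy, zero_mul, add_zero]
  | inv x _ hx => rw [foxDeriv_grp_inv, hx, zero_mul, neg_zero]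

theorem relM_le_foxKer (k : I ⊕ J) : relM N ≤ foxKer N k := by
  classical
  refine sup_le (iSup_le fun i => Subgroup.normalClosure_le_normal ?_) (commutator_le_foxKer N k)
  rintro _ ⟨hn, a, rfl⟩
  refine ⟨hn, ?_⟩
  rw [(isFoxDerivative_foxDeriv _).factor]
  split_ifs
  · exact Ideal.subset_span ⟨_, hn, rfl⟩
  · exact zero_mem _

theorem normalClosure_subProd_le_foxKer {K : Set (I ⊕ J)} {k : I ⊕ J} (hk : k ∉ K) :
    Subgroup.normalClosure ((subProd K ⊓ N : Subgroup (FreeProd A J)) : Set (FreeProd A J)) ≤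
      foxKer N k := by
  refine Subgroup.normalClosure_le_normal ?_
  rintro f ⟨hf, hn⟩
  exact ⟨hn, by rw [foxDeriv_grp_eq_zero hk hf]; exact zero_mem _⟩

end Converse

/-! ### Passage to the quotient and the theorem -/

theorem relM_le [N.Normal] : relM N ≤ N :=
  sup_le (iSup_le fun _ => Subgroup.normalClosure_le_normal inf_le_left)
    (Subgroup.commutator_le_left N N)

instance relM_normal [N.Normal] : (relM N).Normal := by
  have := Subgroup.iSup_normal_of_normal (fun i : I => Subgroup.normalClosure
    ((N ⊓ (factor (J := J) A i).range : Subgroup (FreeProd A J)) : Set (FreeProd A J)))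
    fun i => inferInstance
  exact Subgroup.sup_normal _ _

/-- Subgroups whose intersection lies in `R ≤ N` have disjoint images modulo `R`. -/
theorem disjoint_map_mk' {F : Type*} [Group F] {R N H : Subgroup F} [R.Normal] (hR : R ≤ N)
    (h : H ⊓ N ≤ R) :
    Disjoint (H.map (QuotientGroup.mk' R)) (N.map (QuotientGroup.mk' R)) := by
  rw [Subgroup.disjoint_def]
  rintro _ ⟨x, hx, rfl⟩ ⟨n, hn, e⟩
  have hxn : n⁻¹ * x ∈ R := (QuotientGroup.mk'_eq_mk' R).1 e |> fun ⟨z, hz, hz'⟩ => by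
    rw [← hz', inv_mul_cancel_left]; exact hz
  have : x ∈ N := by simpa using N.mul_mem hn (hR hxn)
  exact (QuotientGroup.eq_one_iff x).2 (h ⟨hx, this⟩)

end FoxCalculus

theorem theorem3 {I : Type*} {J : Type*} (A : I → Type*) [∀ i, Group (A i)]
    [∀ i, Nontrivial (A i)] (N : Subgroup (FoxCalculus.FreeProd A J)) [N.Normal]
    (K : Set (I ⊕ J)) (v : FoxCalculus.FreeProd A J) :
    (∀ k : I ⊕ J, k ∉ K →
        FoxCalculus.foxDeriv k (FoxCalculus.grp v) ∈ FoxCalculus.relIdeal N) ↔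
      ∃ w ∈ FoxCalculus.subProd K,
        v * w⁻¹ ∈ Subgroup.normalClosure
            ((FoxCalculus.subProd K ⊓ N : Subgroup (FoxCalculus.FreeProd A J)) :
              Set (FoxCalculus.FreeProd A J)) ⊔
          FoxCalculus.relM N := by
  constructor
  · intro hv
    set R := Subgroup.normalClosure
      ((FoxCalculus.subProd K ⊓ N : Subgroup (FoxCalculus.FreeProd A J)) :
        Set (FoxCalculus.FreeProd A J)) ⊔ FoxCalculus.relM N
    have hRN : R ≤ N :=
      sup_le (Subgroup.normalClosure_le_normal inf_le_right) (FoxCalculus.relM_le N)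
    have : R.Normal := Subgroup.sup_normal _ _
    have : (N.map (QuotientGroup.mk' R)).Normal :=
      Subgroup.Normal.map ‹_› _ (QuotientGroup.mk'_surjective R)
    have : IsMulCommutative (N.map (QuotientGroup.mk' R)) := by
      refine ⟨⟨?_⟩⟩
      rintro ⟨_, a, ha, rfl⟩ ⟨_, b, hb, rfl⟩
      ext1
      have hab : ⁅a, b⁆ ∈ R :=
        Subgroup.mem_sup_right <| Subgroup.mem_sup_right (Subgroup.commutator_mem_commutator ha hb)
      have h1 : QuotientGroup.mk' R ⁅a, b⁆ = 1 := (QuotientGroup.eq_one_iff _).2 hab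
      rw [map_commutatorElement] at h1
      exact commutatorElement_eq_one_iff_mul_comm.1 h1
    obtain ⟨w, hw, e⟩ := FoxCalculus.mem_map_subProd_of_foxDeriv_mem N (QuotientGroup.mk' R)
      (fun i => FoxCalculus.disjoint_map_mk' hRN
        (le_trans (b := Subgroup.normalClosure
            ((N ⊓ (FoxCalculus.factor (J := J) A i).range :
              Subgroup (FoxCalculus.FreeProd A J)) : Set (FoxCalculus.FreeProd A J)))
          (fun x hx => Subgroup.subset_normalClosure ⟨hx.2, hx.1⟩)
          (le_trans (le_iSup (fun i : I => Subgroup.normalClosure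
            ((N ⊓ (FoxCalculus.factor (J := J) A i).range :
              Subgroup (FoxCalculus.FreeProd A J)) : Set (FoxCalculus.FreeProd A J))) i)
            (le_sup_of_le_right le_sup_left))))
      (FoxCalculus.disjoint_map_mk' hRN
        (le_trans Subgroup.subset_normalClosure (le_sup_left (b := FoxCalculus.relM N)))) hv
    refine ⟨w, hw, (QuotientGroup.eq_one_iff _).1 ?_⟩
    change QuotientGroup.mk' R (v * w⁻¹) = 1
    rw [map_mul, map_inv, e, mul_inv_cancel]
  · rintro ⟨w, hw, h⟩ k hk
    have hker := sup_le (FoxCalculus.normalClosure_subProd_le_foxKer N hk)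
      (FoxCalculus.relM_le_foxKer N k) h
    -- D_k(v) = D_k(vw⁻¹)w + D_k(w), where D_k(w) = 0 because k ∉ K.
    rw [← inv_mul_cancel_right v w, FoxCalculus.foxDeriv_grp_mul,
      FoxCalculus.foxDeriv_grp_eq_zero hk hw, add_zero]
    exact FoxCalculus.mul_grp_mem_relIdeal N hker.2 w
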